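/- For every $N\in\mathbb N$ let $J_N\in\mathbb R$ and $\sigma_N>0$, and let $\mu_N$ be the Gibbs measure of the periodic XY chain of $N$ rotors, that is, the probability measure on $\mathcal S^N$, with $\mathcal S=\mathbb R/2\pi\mathbb Z$, given by $$\mathrm d\mu_N(x)=\frac{1}{\mathcal Z_N}\,e^{-\frac{1}{2\sigma_N^2}H_N(x)}\,\mathrm d\lambda(x),\qquad H_N(x)=-J_N\sum_{i=1}^N\cos(x_i-x_{i-1}),\quad x_0=x_N,$$ where $\lambda$ is the Lebesgue measure on $\mathcal S^N$ and $\mathcal Z_N$ is the normalization constant. For $\theta\in\mathcal S$ let $\tilde\theta\in(-\pi,\pi]$ be its representative, and let $$W^{(N)}(x)=\frac1{2\pi}\sum_{i=1}^N\widetilde{x_i-x_{i-1}}$$ be the winding number, which is well defined when $x_i-x_{i-1}\neq\pi$ for all $i$. Assume that $J_N/\sigma_N^2\to\infty$ as $N\to\infty$. (1) If $J_N/\sigma_N^2=o(N)$, then, under $\mu_N$, $$2\pi\sqrt{\frac{J_N}{2\sigma_N^2N}}\;W^{(N)}\longrightarrow\mathcal N(0,1)\quad\text{in distribution as }N\to\infty.$$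 (2) If $N=o(J_N/\sigma_N^2)$, then $\mu_N\big(W^{(N)}\text{ is well defined and }W^{(N)}=0\big)\to1$ as $N\to\infty$. -/

import Mathlib

open MeasureTheory ProbabilityTheory Filter Topology Asymptotics

noncomputable section

namespace XYChain

instance fact_two_pi_pos : Fact ((0 : ℝ) < 2 * Real.pi) := ⟨Real.two_pi_pos⟩

/-- The circle `ℝ / 2πℤ` in which each rotor takes its values. Its `volume` is Lebesgue measure,
of total mass `2π`. -/
abbrev Rotor : Type := AddCircle (2 * Real.pi)

/-- Configurations of a chain of `N` rotors. The sites are `0, …, N - 1`, read cyclically; the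
reference measure `volume` is the product of the Lebesgue measures. -/
abbrev Config (N : ℕ) : Type := Fin N → Rotor

/-- The cosine of an angle. -/
def cosine (θ : Rotor) : ℝ := Real.cos_periodic.lift θ

/-- The representative of an angle in `(-π, π]`. -/
def rep (θ : Rotor) : ℝ := (AddCircle.equivIoc (2 * Real.pi) (-Real.pi) θ : ℝ)

/-- The angle between the rotor at site `i` and the preceding one, `x i - x (i - 1)`, with periodic
boundary conditions: the site before `0` is `N - 1`. -/
def increment {N : ℕ} (x : Config N) (i : Fin N) : Rotor := x i - x ((finRotate N).symm i)

/-- The XY Hamiltonian of the periodic chain with coupling constant `J`. -/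
def hamiltonian (J : ℝ) {N : ℕ} (x : Config N) : ℝ := -J * ∑ i, cosine (increment x i)

/-- The Gibbs measure at inverse temperature `1 / (2σ²)`, that is, the probability measure
proportional to `exp (- H / (2σ²))` times Lebesgue measure. -/
def gibbs (J σ : ℝ) (N : ℕ) : Measure (Config N) :=
  (volume : Measure (Config N)).tilted fun x => -(1 / (2 * σ ^ 2)) * hamiltonian J x

/-- The configurations in which no two neighbouring rotors point in opposite directions. -/
def WindingDefined {N : ℕ} (x : Config N) : Prop :=
  ∀ i, increment x i ≠ ((Real.pi : ℝ) : Rotor)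

/-- The winding number. It is genuine where `WindingDefined` holds; on the remaining
configurations, which are a null set, it is given by the same formula. -/
def windingNumber {N : ℕ} (x : Config N) : ℝ :=
  1 / (2 * Real.pi) * ∑ i, rep (increment x i)

theorem continuous_cosine : Continuous cosine :=
  continuous_coinduced_dom.mpr Real.continuous_cos

theorem continuous_hamiltonian (J : ℝ) (N : ℕ) :
    Continuous (hamiltonian J : Config N → ℝ) := by
  unfold hamiltonian increment
  refine continuous_const.mul (continuous_finsetSum _ fun i _ => continuous_cosine.comp ?_)
  fun_prop

instance isProbabilityMeasure_gibbs (J σ : ℝ) (N : ℕ) :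
    IsProbabilityMeasure (gibbs J σ N) := by
  have hc : Continuous fun x : Config N => Real.exp (-(1 / (2 * σ ^ 2)) * hamiltonian J x) :=
    Real.continuous_exp.comp (continuous_const.mul (continuous_hamiltonian J N))
  exact isProbabilityMeasure_tilted
    (hc.integrable_of_hasCompactSupport (HasCompactSupport.of_compactSpace _))

end XYChain

end

/-!
Write `κ = J / (2σ²)`. Under the Gibbs measure the increments of the chain are independent von Mises
variables of concentration `κ`, conditioned on their sum being `0` modulo `2π`, and `2π` times the
winding number is the sum of their representatives in `(-π, π]`.

Twisting the weight by the character `exp (i s θ)` of the representatives gives an integral of a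
cyclic product of functions of the increments, which is the trace of a power of a convolution
operator on the circle (`hasSum_circleCoeff_pow`, by Parseval's identity). Hence the characteristic
function of `2π` times the winding number is an exact ratio `F(s) / F(0)` (`integral_gibbs_exp`),
where `F(s) = ∑ φ(s + m) ^ N`, the sum being over all integers `m`, and `φ` is the characteristic
function of the von Mises law.

Two facts about `φ` suffice, and both follow from integration by parts against the von Mises
density (`vonMisesExp_stein`). By `tendsto_vonMisesChar_pow`, if `κ → ∞` and `N s² / κ → v` then
`φ(s) ^ N → exp (-v / 2)`. By `abs_vonMisesChar_pow_le`, `|φ(ξ)| ^ N ≤ 1 / (1 + N ξ² / (12 κ))` as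
soon as `|ξ| ≥ 1/2`, which serves as the dominating function in both regimes.

* If `κ / N → 0`, then with `s = t √(κ / N)` every term of `F(s)` but `m = 0` disappears, so that
  `F(s) / F(0) → exp (-t² / 2)`, and Lévy's theorem applies.
* If `κ / N → ∞`, then `√(N / κ) F(s)` is a Riemann sum of vanishing mesh for the Gaussian integral,
  so its limit does not depend on `s`, and `F(s) / F(0) → 1` for every `s`. The winding number thus
  tends to `0` in probability; being an integer, it vanishes with probability tending to `1`.
-/

noncomputable section

namespace XYChain

/-! ### The von Mises law -/

/-- The total mass of the weight `exp (κ cos θ)` on `(-π, π)`. -/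
def vonMisesMass (κ : ℝ) : ℝ := ∫ θ in (-Real.pi)..Real.pi, Real.exp (κ * Real.cos θ)

/-- The expectation of `g` under the von Mises law of concentration `κ`, the probability law on
`(-π, π)` with density proportional to `exp (κ cos θ)`. -/
def vonMisesExp (κ : ℝ) (g : ℝ → ℝ) : ℝ :=
  (∫ θ in (-Real.pi)..Real.pi, g θ * Real.exp (κ * Real.cos θ)) / vonMisesMass κ

/-- The characteristic function of the von Mises law, which is real because the law is symmetric. -/
def vonMisesChar (κ ξ : ℝ) : ℝ := vonMisesExp κ fun θ => Real.cos (ξ * θ)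

/-- The von Mises density at the antipodal point `π`. -/
def antipodalDensity (κ : ℝ) : ℝ := Real.exp (-κ) / vonMisesMass κ

lemma two_mul_exp_half_le_vonMisesMass {κ : ℝ} (hκ : 0 ≤ κ) :
    2 * Real.exp (κ / 2) ≤ vonMisesMass κ := by
  have hpi := Real.pi_gt_three
  calc 2 * Real.exp (κ / 2) = ∫ _ in (-1 : ℝ)..1, Real.exp (κ / 2) := by
        rw [intervalIntegral.integral_const, smul_eq_mul]; ring
    _ ≤ ∫ θ in (-1 : ℝ)..1, Real.exp (κ * Real.cos θ) := by
        refine intervalIntegral.integral_mono_on (by norm_num)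
          (Continuous.intervalIntegrable (by fun_prop) _ _)
          (Continuous.intervalIntegrable (by fun_prop) _ _) fun θ hθ => ?_
        have h1 := Real.one_sub_sq_div_two_le_cos (x := θ)
        have h2 : θ ^ 2 ≤ 1 := by nlinarith [hθ.1, hθ.2]
        gcongr
        nlinarith
    _ ≤ vonMisesMass κ :=
        intervalIntegral.integral_mono_interval (by linarith) (by norm_num) (by linarith)
          (Eventually.of_forall fun θ => (Real.exp_pos _).le)
          (Continuous.intervalIntegrable (by fun_prop) _ _)

lemma vonMisesMass_pos (κ : ℝ) : 0 < vonMisesMass κ :=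
  intervalIntegral.intervalIntegral_pos_of_pos (Continuous.intervalIntegrable (by fun_prop) _ _)
    (fun _ => Real.exp_pos _) (by linarith [Real.pi_pos])

lemma vonMisesExp_mono {κ : ℝ} {g h : ℝ → ℝ} (hg : Continuous g) (hh : Continuous h)
    (H : ∀ θ, |θ| ≤ Real.pi → g θ ≤ h θ) : vonMisesExp κ g ≤ vonMisesExp κ h := by
  unfold vonMisesExp
  have := vonMisesMass_pos κ
  gcongr
  refine intervalIntegral.integral_mono_on (by linarith [Real.pi_pos])
    (Continuous.intervalIntegrable (by fun_prop) _ _)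
    (Continuous.intervalIntegrable (by fun_prop) _ _) fun θ hθ => ?_
  have := H θ (abs_le.mpr hθ)
  gcongr

lemma vonMisesExp_add {κ : ℝ} {g h : ℝ → ℝ} (hg : Continuous g) (hh : Continuous h) :
    vonMisesExp κ (fun θ => g θ + h θ) = vonMisesExp κ g + vonMisesExp κ h := by
  unfold vonMisesExp
  rw [← add_div, ← intervalIntegral.integral_add (Continuous.intervalIntegrable (by fun_prop) _ _)
    (Continuous.intervalIntegrable (by fun_prop) _ _)]
  simp only [add_mul]

lemma vonMisesExp_sub {κ : ℝ} {g h : ℝ → ℝ} (hg : Continuous g) (hh : Continuous h) :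
    vonMisesExp κ (fun θ => g θ - h θ) = vonMisesExp κ g - vonMisesExp κ h := by
  unfold vonMisesExp
  rw [← sub_div, ← intervalIntegral.integral_sub (Continuous.intervalIntegrable (by fun_prop) _ _)
    (Continuous.intervalIntegrable (by fun_prop) _ _)]
  simp only [sub_mul]

lemma vonMisesExp_const_mul (κ c : ℝ) (g : ℝ → ℝ) :
    vonMisesExp κ (fun θ => c * g θ) = c * vonMisesExp κ g := by
  unfold vonMisesExp
  simp only [mul_assoc, intervalIntegral.integral_const_mul, mul_div_assoc]

lemma vonMisesExp_const (κ c : ℝ) : vonMisesExp κ (fun _ => c) = c := by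
  unfold vonMisesExp
  rw [intervalIntegral.integral_const_mul]
  exact mul_div_cancel_right₀ c (vonMisesMass_pos κ).ne'

lemma vonMisesExp_nonneg {κ : ℝ} {g : ℝ → ℝ} (hg : Continuous g)
    (H : ∀ θ, |θ| ≤ Real.pi → 0 ≤ g θ) : 0 ≤ vonMisesExp κ g := by
  rw [← vonMisesExp_const κ 0]
  exact vonMisesExp_mono continuous_const hg H

/-- Integration by parts against the von Mises density, whose logarithmic derivative is
`-κ sin θ`. The boundary term vanishes for `2π`-periodic `u`. -/
lemma vonMisesExp_stein (κ : ℝ) {u v : ℝ → ℝ} (hu : ∀ θ, HasDerivAt u (v θ) θ)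
    (hv : Continuous v) :
    κ * vonMisesExp κ (fun θ => u θ * Real.sin θ) =
      vonMisesExp κ v - (u Real.pi - u (-Real.pi)) * antipodalDensity κ := by
  have hcu : Continuous u := continuous_iff_continuousAt.mpr fun θ => (hu θ).continuousAt
  have hd : ∀ θ, HasDerivAt (fun θ => u θ * Real.exp (κ * Real.cos θ))
      (v θ * Real.exp (κ * Real.cos θ) - κ * (u θ * Real.sin θ * Real.exp (κ * Real.cos θ))) θ := by
    intro θ
    have h := (hu θ).mul (((Real.hasDerivAt_cos θ).const_mul κ).exp)
    refine h.congr_deriv ?_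
    ring
  have hI := intervalIntegral.integral_eq_sub_of_hasDerivAt (a := -Real.pi) (b := Real.pi)
    (fun θ _ => hd θ) (Continuous.intervalIntegrable (by fun_prop) _ _)
  rw [intervalIntegral.integral_sub (Continuous.intervalIntegrable (by fun_prop) _ _)
    (Continuous.intervalIntegrable (by fun_prop) _ _), intervalIntegral.integral_const_mul] at hI
  simp only [Real.cos_neg, Real.cos_pi, mul_neg, mul_one] at hI
  have hZ := (vonMisesMass_pos κ).ne'
  unfold vonMisesExp antipodalDensity
  field_simp
  linarith

lemma antipodalDensity_nonneg (κ : ℝ) : 0 ≤ antipodalDensity κ :=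
  div_nonneg (Real.exp_pos _).le (vonMisesMass_pos κ).le

lemma antipodalDensity_le {κ : ℝ} (hκ : 2 ≤ κ) : antipodalDensity κ ≤ 1 / 12 := by
  have h1 := two_mul_exp_half_le_vonMisesMass (κ := κ) (by linarith)
  have h2 := Real.add_one_le_exp (κ / 2)
  have h3 : Real.exp (-κ) ≤ 1 / 3 := by
    rw [Real.exp_neg, inv_eq_one_div]
    have := Real.add_one_le_exp κ
    gcongr
    linarith
  unfold antipodalDensity
  rw [div_le_div_iff₀ (vonMisesMass_pos κ) (by norm_num)]
  linarith

lemma tendsto_antipodalDensity : Tendsto antipodalDensity atTop (𝓝 0) := by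
  have h0 : Tendsto (fun κ : ℝ => Real.exp (-κ)) atTop (𝓝 0) :=
    Real.tendsto_exp_neg_atTop_nhds_zero
  refine squeeze_zero' (Eventually.of_forall antipodalDensity_nonneg) ?_ h0
  filter_upwards [eventually_ge_atTop (0 : ℝ)] with κ hκ
  have h1 := two_mul_exp_half_le_vonMisesMass hκ
  have h2 := Real.add_one_le_exp (κ / 2)
  exact div_le_self (Real.exp_pos _).le (by linarith)

/-! ### Decay of the characteristic function -/

lemma vonMisesExp_sin_sq_le {κ : ℝ} : κ * vonMisesExp κ (fun θ => Real.sin θ * Real.sin θ) ≤ 1 := by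
  rw [vonMisesExp_stein κ Real.hasDerivAt_sin Real.continuous_cos]
  have : vonMisesExp κ Real.cos ≤ vonMisesExp κ fun _ => 1 :=
    vonMisesExp_mono Real.continuous_cos continuous_const fun θ _ => Real.cos_le_one θ
  rw [vonMisesExp_const] at this
  simpa using this

lemma abs_vonMisesChar_le_one (κ ξ : ℝ) : |vonMisesChar κ ξ| ≤ 1 := by
  have hc : Continuous fun θ : ℝ => Real.cos (ξ * θ) := by fun_prop
  rw [abs_le]
  constructor
  · rw [← vonMisesExp_const κ (-1)]
    exact vonMisesExp_mono continuous_const hc fun θ _ => Real.neg_one_le_cos _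
  · rw [← vonMisesExp_const κ 1]
    exact vonMisesExp_mono hc continuous_const fun θ _ => Real.cos_le_one _

/-- Integrating `ξ cos (ξθ)` by parts and applying the Cauchy-Schwarz inequality bounds
`ξ φ(ξ)`, up to the boundary term, by the variance-like quantity `1 - φ(ξ)²`. -/
lemma sq_mul_vonMisesChar_sub_le {κ : ℝ} (hκ : 0 < κ) (ξ : ℝ) :
    (ξ * vonMisesChar κ ξ - 2 * Real.sin (ξ * Real.pi) * antipodalDensity κ) ^ 2 ≤
      κ * (1 - vonMisesChar κ ξ ^ 2) := by
  set φ := vonMisesChar κ ξ with hφ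
  set B := κ * vonMisesExp κ fun θ => Real.sin (ξ * θ) * Real.sin θ with hB
  have hst : B = ξ * φ - 2 * Real.sin (ξ * Real.pi) * antipodalDensity κ := by
    rw [hB, vonMisesExp_stein κ (u := fun θ => Real.sin (ξ * θ))
      (v := fun θ => ξ * Real.cos (ξ * θ)) (fun θ => ?_) (by fun_prop), vonMisesExp_const_mul]
    · simp only [mul_neg, Real.sin_neg]
      rw [hφ, vonMisesChar]
      ring
    · have h := ((hasDerivAt_id θ).const_mul ξ).sin
      refine h.congr_deriv ?_
      simp [mul_comm]
  rw [← hst]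
  have hss := vonMisesExp_sin_sq_le (κ := κ)
  set S := vonMisesExp κ fun θ => Real.sin θ * Real.sin θ
  set V := vonMisesExp κ fun θ => Real.sin (ξ * θ) ^ 2 with hV
  set C := vonMisesExp κ fun θ => Real.cos (ξ * θ) ^ 2 with hC
  have hVC : V + C = 1 := by
    rw [hV, hC, ← vonMisesExp_add (by fun_prop) (by fun_prop)]
    simp [vonMisesExp_const]
  -- the second moment of the cosine dominates the squared mean
  have h1 : φ ^ 2 ≤ C := by
    have h : 0 ≤ vonMisesExp κ fun θ =>
        (Real.cos (ξ * θ) ^ 2 - (2 * φ) * Real.cos (ξ * θ)) + φ ^ 2 :=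
      vonMisesExp_nonneg (by fun_prop) fun θ _ => by
        nlinarith [sq_nonneg (Real.cos (ξ * θ) - φ)]
    rw [vonMisesExp_add (by fun_prop) (by fun_prop), vonMisesExp_sub (by fun_prop) (by fun_prop),
      vonMisesExp_const_mul, vonMisesExp_const] at h
    change 0 ≤ C - 2 * φ * φ + φ ^ 2 at h
    nlinarith
  -- Cauchy-Schwarz, as positivity of the quadratic form at its minimizer
  have h2 : B ^ 2 ≤ κ * V := by
    have h : 0 ≤ vonMisesExp κ fun θ => (Real.sin (ξ * θ) ^ 2
        - (2 * B) * (Real.sin (ξ * θ) * Real.sin θ)) + B ^ 2 * (Real.sin θ * Real.sin θ) :=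
      vonMisesExp_nonneg (by fun_prop) fun θ _ => by
        nlinarith [sq_nonneg (Real.sin (ξ * θ) - B * Real.sin θ)]
    rw [vonMisesExp_add (by fun_prop) (by fun_prop), vonMisesExp_sub (by fun_prop) (by fun_prop),
      vonMisesExp_const_mul, vonMisesExp_const_mul] at h
    have h' := mul_nonneg hκ.le h
    have e : κ * (V - 2 * B * vonMisesExp κ (fun θ => Real.sin (ξ * θ) * Real.sin θ) + B ^ 2 * S)
        = κ * V - 2 * B * B + B ^ 2 * (κ * S) := by
      rw [hB]; ring
    rw [e] at h'
    nlinarith [mul_le_mul_of_nonneg_left hss (sq_nonneg B)]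
  nlinarith

lemma vonMisesChar_sq_le {κ ξ : ℝ} (hκ : 2 ≤ κ) (hξ : 1 / 2 ≤ |ξ|) :
    vonMisesChar κ ξ ^ 2 ≤ 1 / (1 + ξ ^ 2 / (4 * κ)) := by
  have h := sq_mul_vonMisesChar_sub_le (κ := κ) (by linarith) ξ
  set φ := vonMisesChar κ ξ
  set b := 2 * Real.sin (ξ * Real.pi) * antipodalDensity κ with hb
  have hb2 : b ^ 2 ≤ 1 / 36 := by
    have h1 := antipodalDensity_nonneg κ
    have h2 := antipodalDensity_le hκ
    have h3 := Real.sin_sq_le_one (ξ * Real.pi)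
    have : b ^ 2 = 4 * Real.sin (ξ * Real.pi) ^ 2 * antipodalDensity κ ^ 2 := by rw [hb]; ring
    rw [this]
    have h4 : antipodalDensity κ ^ 2 ≤ (1 / 12) ^ 2 := by gcongr
    nlinarith [sq_nonneg (Real.sin (ξ * Real.pi)), sq_nonneg (antipodalDensity κ)]
  have hξ2 : 1 / 4 ≤ ξ ^ 2 := by
    rw [← sq_abs]; nlinarith
  have hk : 0 < κ := by linarith
  rw [show 1 / (1 + ξ ^ 2 / (4 * κ)) = 4 * κ / (4 * κ + ξ ^ 2) by field_simp,
    le_div_iff₀ (by positivity)]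
  have h5 : (ξ * φ) ^ 2 ≤ 2 * (κ * (1 - φ ^ 2)) + 2 * (1 / 36) := by
    nlinarith [sq_nonneg (ξ * φ - 2 * b)]
  -- `φ² (2κ + ξ²) ≤ 2κ + 1/18`, and the constant is absorbed using `ξ² ≥ 1/4`
  have h6 : φ ^ 2 * (2 * κ + ξ ^ 2) ≤ 2 * κ + 1 / 18 := by nlinarith
  have h7 : (2 * κ + 1 / 18) * (4 * κ + ξ ^ 2) ≤ 4 * κ * (2 * κ + ξ ^ 2) := by nlinarith
  have h8 : 0 < 2 * κ + ξ ^ 2 := by positivity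
  refine le_of_mul_le_mul_right ?_ h8
  calc φ ^ 2 * (4 * κ + ξ ^ 2) * (2 * κ + ξ ^ 2)
      = φ ^ 2 * (2 * κ + ξ ^ 2) * (4 * κ + ξ ^ 2) := by ring
    _ ≤ (2 * κ + 1 / 18) * (4 * κ + ξ ^ 2) := by gcongr
    _ ≤ _ := h7

/-- Since `|φ| ≤ 1`, the `N` factors may be paired into `N / 2` squares; Bernoulli's inequality then
turns the power into a bound that decays like `κ / (N ξ²)`, hence is summable in `ξ ∈ s + ℤ`. -/
lemma abs_vonMisesChar_pow_le {κ ξ : ℝ} (hκ : 2 ≤ κ) (hξ : 1 / 2 ≤ |ξ|) {N : ℕ} (hN : 2 ≤ N) :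
    |vonMisesChar κ ξ| ^ N ≤ 1 / (1 + N * ξ ^ 2 / (12 * κ)) := by
  have hk : 0 < κ := by linarith
  have ha : 0 ≤ ξ ^ 2 / (4 * κ) := by positivity
  have hN3 : (N : ℝ) / 3 ≤ (N / 2 : ℕ) := by
    have : N ≤ 3 * (N / 2) := by omega
    have : (N : ℝ) ≤ 3 * (N / 2 : ℕ) := by exact_mod_cast this
    linarith
  calc |vonMisesChar κ ξ| ^ N ≤ |vonMisesChar κ ξ| ^ (2 * (N / 2)) :=
        pow_le_pow_of_le_one (abs_nonneg _) (abs_vonMisesChar_le_one κ ξ) (Nat.mul_div_le N 2)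
    _ = (vonMisesChar κ ξ ^ 2) ^ (N / 2) := by rw [pow_mul, sq_abs]
    _ ≤ (1 / (1 + ξ ^ 2 / (4 * κ))) ^ (N / 2) := by gcongr; exact vonMisesChar_sq_le hκ hξ
    _ = 1 / (1 + ξ ^ 2 / (4 * κ)) ^ (N / 2) := by rw [div_pow, one_pow]
    _ ≤ 1 / (1 + N * ξ ^ 2 / (12 * κ)) := by
        gcongr
        calc 1 + N * ξ ^ 2 / (12 * κ) = 1 + N / 3 * (ξ ^ 2 / (4 * κ)) := by field_simp; ring
          _ ≤ 1 + (N / 2 : ℕ) * (ξ ^ 2 / (4 * κ)) := by gcongr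
          _ ≤ (1 + ξ ^ 2 / (4 * κ)) ^ (N / 2) := one_add_mul_le_pow (by linarith) _

/-! ### Moments and the Gaussian limit of the characteristic function -/

lemma sq_div_vonMisesMass_le {κ : ℝ} (hκ : 0 ≤ κ) : κ ^ 2 / vonMisesMass κ ≤ 4 := by
  have h1 := two_mul_exp_half_le_vonMisesMass hκ
  have h2 := Real.quadratic_le_exp_of_nonneg (x := κ / 2) (by linarith)
  rw [div_le_iff₀ (vonMisesMass_pos κ)]
  nlinarith

/-- Where `|θ| ≤ π/2` the weight is controlled by Jordan's inequality `|θ| ≤ (π/2) |sin θ|`, and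
elsewhere the density is at most `1 / vonMisesMass κ`. -/
lemma vonMisesExp_pow_le {κ : ℝ} (hκ : 0 ≤ κ) {n : ℕ} (hn : Odd n) :
    vonMisesExp κ (fun θ => θ ^ (n + 1)) ≤
      2 * vonMisesExp κ (fun θ => θ ^ n * Real.sin θ) + 8 * 4 ^ (n + 1) / vonMisesMass κ := by
  have hpi := Real.pi_lt_four
  have hpi3 := Real.pi_gt_three
  have hmass : 8 * (4 : ℝ) ^ (n + 1) / vonMisesMass κ ≥
      (∫ _ in (-Real.pi)..Real.pi, (4 : ℝ) ^ (n + 1)) / vonMisesMass κ := by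
    have := vonMisesMass_pos κ
    rw [intervalIntegral.integral_const, smul_eq_mul]
    gcongr
    linarith
  refine le_trans ?_ (add_le_add_right hmass _)
  rw [← vonMisesExp_const_mul]
  unfold vonMisesExp
  rw [← add_div, ← intervalIntegral.integral_add (Continuous.intervalIntegrable (by fun_prop) _ _)
    (Continuous.intervalIntegrable (by fun_prop) _ _)]
  have := vonMisesMass_pos κ
  gcongr
  refine intervalIntegral.integral_mono_on (by linarith)
    (Continuous.intervalIntegrable (by fun_prop) _ _)
    (Continuous.intervalIntegrable (by fun_prop) _ _) fun θ hθ => ?_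
  -- both sides are even in `θ`
  have key : ∀ t : ℝ, 0 ≤ t → t ≤ Real.pi → t ^ (n + 1) * Real.exp (κ * Real.cos t) ≤
      2 * (t ^ n * Real.sin t) * Real.exp (κ * Real.cos t) + 4 ^ (n + 1) := by
    intro t ht0 htpi
    have hs := Real.sin_nonneg_of_nonneg_of_le_pi ht0 htpi
    rcases le_total t (Real.pi / 2) with h | h
    · have h1 : t ≤ 2 * Real.sin t := by
        have h2 := Real.mul_le_sin ht0 h
        rw [div_mul_eq_mul_div, div_le_iff₀ Real.pi_pos] at h2
        nlinarith
      have h3 : t ^ (n + 1) ≤ 2 * (t ^ n * Real.sin t) := by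
        rw [pow_succ]
        nlinarith [mul_le_mul_of_nonneg_left h1 (pow_nonneg ht0 n)]
      have h4 : (0 : ℝ) ≤ 4 ^ (n + 1) := by positivity
      nlinarith [mul_le_mul_of_nonneg_right h3 (Real.exp_pos (κ * Real.cos t)).le]
    · have h1 : Real.cos t ≤ 0 := Real.cos_nonpos_of_pi_div_two_le_of_le h (by linarith)
      have h2 : Real.exp (κ * Real.cos t) ≤ 1 := Real.exp_le_one_iff.mpr (by nlinarith)
      have h3 : t ^ (n + 1) ≤ 4 ^ (n + 1) := by gcongr; linarith
      have h4 : 0 ≤ 2 * (t ^ n * Real.sin t) * Real.exp (κ * Real.cos t) := by positivity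
      calc t ^ (n + 1) * Real.exp (κ * Real.cos t) ≤ t ^ (n + 1) * 1 := by gcongr
        _ ≤ _ := by linarith
  have hk := key |θ| (abs_nonneg θ) (abs_le.mpr hθ)
  rw [Real.cos_abs] at hk
  rcases abs_cases θ with ⟨h, _⟩ | ⟨h, _⟩
  · rwa [h] at hk
  · rw [h, hn.neg_pow, hn.add_one.neg_pow, Real.sin_neg, neg_mul_neg] at hk
    exact hk

lemma vonMisesExp_mul_sin_id (κ : ℝ) :
    κ * vonMisesExp κ (fun θ => θ * Real.sin θ) = 1 - 2 * Real.pi * antipodalDensity κ := by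
  rw [vonMisesExp_stein κ (u := fun θ => θ) (v := fun _ => 1) (fun θ => hasDerivAt_id θ)
    continuous_const, vonMisesExp_const]
  ring

lemma exists_vonMisesExp_fourth_le :
    ∃ C : ℝ, 0 ≤ C ∧ ∀ κ, 1 ≤ κ → κ ^ 2 * vonMisesExp κ (fun θ => θ ^ 4) ≤ C := by
  refine ⟨6 * (2 + 8 * 4 ^ 2 * 4) + 8 * 4 ^ 4 * 4, by norm_num, fun κ hκ => ?_⟩
  have hZ := sq_div_vonMisesMass_le (κ := κ) (by linarith)
  have hZ0 := vonMisesMass_pos κ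
  have ha := antipodalDensity_nonneg κ
  have h2 : κ * vonMisesExp κ (fun θ => θ ^ 2) ≤ 2 + 8 * 4 ^ 2 * 4 := by
    have h := vonMisesExp_pow_le (κ := κ) (by linarith) (n := 1) odd_one
    simp only [pow_one] at h
    have h1 := vonMisesExp_mul_sin_id κ
    have h3 : κ * (8 * 4 ^ (1 + 1) / vonMisesMass κ) ≤ 8 * 4 ^ 2 * 4 := by
      calc κ * (8 * 4 ^ (1 + 1) / vonMisesMass κ) ≤ κ ^ 2 * (8 * 4 ^ (1 + 1) / vonMisesMass κ) := by
            gcongr; nlinarith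
        _ = 8 * 4 ^ 2 * (κ ^ 2 / vonMisesMass κ) := by ring
        _ ≤ _ := by gcongr
    have h4 := mul_le_mul_of_nonneg_left h (by linarith : 0 ≤ κ)
    have h5 : 0 ≤ 2 * Real.pi * antipodalDensity κ := by positivity
    norm_num at h4 h3 ⊢
    nlinarith
  have h := vonMisesExp_pow_le (κ := κ) (by linarith) (n := 3) (by decide)
  have h1 : κ * vonMisesExp κ (fun θ => θ ^ 3 * Real.sin θ) ≤
      3 * vonMisesExp κ (fun θ => θ ^ 2) := by
    rw [vonMisesExp_stein κ (u := fun θ => θ ^ 3) (v := fun θ => 3 * θ ^ 2)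
      (fun θ => by simpa using hasDerivAt_pow 3 θ) (by fun_prop), vonMisesExp_const_mul]
    have : 0 ≤ (Real.pi ^ 3 - (-Real.pi) ^ 3) * antipodalDensity κ := by
      have : (-Real.pi) ^ 3 = - Real.pi ^ 3 := by ring
      rw [this]
      have := Real.pi_pos
      rw [sub_neg_eq_add]
      positivity
    linarith
  have h3 : κ ^ 2 * (8 * 4 ^ (3 + 1) / vonMisesMass κ) ≤ 8 * 4 ^ 4 * 4 := by
    calc κ ^ 2 * (8 * 4 ^ (3 + 1) / vonMisesMass κ)
        = 8 * 4 ^ 4 * (κ ^ 2 / vonMisesMass κ) := by ring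
      _ ≤ _ := by gcongr
  have h4 := mul_le_mul_of_nonneg_left h (by positivity : 0 ≤ κ ^ 2)
  have h5 := mul_le_mul_of_nonneg_left h1 (by linarith : 0 ≤ κ)
  calc κ ^ 2 * vonMisesExp κ (fun θ => θ ^ 4)
      ≤ 2 * (κ * (κ * vonMisesExp κ (fun θ => θ ^ 3 * Real.sin θ)))
          + κ ^ 2 * (8 * 4 ^ (3 + 1) / vonMisesMass κ) := by
        refine h4.trans (le_of_eq ?_); ring
    _ ≤ 6 * (κ * vonMisesExp κ (fun θ => θ ^ 2)) + 8 * 4 ^ 4 * 4 := by linarith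
    _ ≤ _ := by gcongr

lemma abs_cos_sub_le (x : ℝ) : |Real.cos x - (1 - x ^ 2 / 2)| ≤ x ^ 4 := by
  rcases le_total |x| 1 with h | h
  · have := Real.cos_bound h
    rw [Even.pow_abs (by decide : Even 4)] at this
    nlinarith [pow_nonneg (sq_nonneg x) 2, (by ring : x ^ 4 = (x ^ 2) ^ 2)]
  · have h2 : 1 ≤ x ^ 2 := by rw [← sq_abs]; nlinarith
    have := Real.one_sub_sq_div_two_le_cos (x := x)
    have := Real.cos_le_one x
    rw [abs_of_nonneg (by linarith)]
    nlinarith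

lemma abs_sq_sub_mul_sin_le (x : ℝ) : |x ^ 2 - x * Real.sin x| ≤ x ^ 4 := by
  have key : ∀ t : ℝ, 0 ≤ t → |t ^ 2 - t * Real.sin t| ≤ t ^ 4 := by
    intro t ht
    have h1 := Real.sin_le ht
    have h2 := Real.sin_ge_sub_cube ht
    rw [abs_of_nonneg (by nlinarith)]
    nlinarith [mul_le_mul_of_nonneg_left h2 ht, pow_nonneg ht 4]
  rcases le_total 0 x with h | h
  · exact key x h
  · simpa [Even.neg_pow (by decide : Even 4)] using key (-x) (by linarith)

lemma tendsto_vonMisesExp_sq :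
    Tendsto (fun κ => κ * vonMisesExp κ (fun θ => θ ^ 2)) atTop (𝓝 1) := by
  obtain ⟨C, hC0, hC⟩ := exists_vonMisesExp_fourth_le
  have h1 : Tendsto (fun κ => κ * vonMisesExp κ (fun θ => θ * Real.sin θ)) atTop (𝓝 1) := by
    simp_rw [vonMisesExp_mul_sin_id]
    simpa using (tendsto_antipodalDensity.const_mul (2 * Real.pi)).const_sub 1
  have h2 : Tendsto (fun κ => κ * vonMisesExp κ (fun θ => θ ^ 2)
      - κ * vonMisesExp κ (fun θ => θ * Real.sin θ)) atTop (𝓝 0) := by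
    have h0 : Tendsto (fun κ : ℝ => C / κ) atTop (𝓝 0) := tendsto_const_nhds.div_atTop tendsto_id
    refine squeeze_zero_norm' ?_ h0
    filter_upwards [eventually_ge_atTop (1 : ℝ)] with κ hκ
    have hk : 0 < κ := by linarith
    rw [← mul_sub, ← vonMisesExp_sub (by fun_prop) (by fun_prop), Real.norm_eq_abs, abs_mul,
      abs_of_pos hk, le_div_iff₀ hk]
    have h3 : |vonMisesExp κ (fun θ => θ ^ 2 - θ * Real.sin θ)| ≤
        vonMisesExp κ (fun θ => θ ^ 4) := by
      rw [abs_le]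
      constructor
      · have e : -vonMisesExp κ (fun θ => θ ^ 4) = vonMisesExp κ (fun θ => (-1) * θ ^ 4) := by
          rw [vonMisesExp_const_mul]; ring
        rw [e]
        exact vonMisesExp_mono (by fun_prop) (by fun_prop) fun θ _ => by
          linarith [(abs_le.mp (abs_sq_sub_mul_sin_le θ)).1]
      · exact vonMisesExp_mono (by fun_prop) (by fun_prop) fun θ _ =>
          (abs_le.mp (abs_sq_sub_mul_sin_le θ)).2
    nlinarith [hC κ hκ]
  simpa using h2.add h1

lemma abs_vonMisesChar_sub_le (κ s : ℝ) :
    |vonMisesChar κ s - (1 - s ^ 2 / 2 * vonMisesExp κ (fun θ => θ ^ 2))| ≤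
      s ^ 4 * vonMisesExp κ (fun θ => θ ^ 4) := by
  have e : vonMisesChar κ s - (1 - s ^ 2 / 2 * vonMisesExp κ (fun θ => θ ^ 2)) =
      vonMisesExp κ fun θ => Real.cos (s * θ) - (1 - s ^ 2 / 2 * θ ^ 2) := by
    rw [vonMisesExp_sub (by fun_prop) (by fun_prop), vonMisesExp_sub (by fun_prop) (by fun_prop),
      vonMisesExp_const, vonMisesExp_const_mul]
    rfl
  have hb : ∀ θ, |Real.cos (s * θ) - (1 - s ^ 2 / 2 * θ ^ 2)| ≤ s ^ 4 * θ ^ 4 := fun θ => by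
    have := abs_cos_sub_le (s * θ)
    rwa [mul_pow, mul_pow, mul_div_right_comm] at this
  rw [e, abs_le]
  constructor
  · have e' : -(s ^ 4 * vonMisesExp κ (fun θ => θ ^ 4)) =
        vonMisesExp κ (fun θ => (-s ^ 4) * θ ^ 4) := by
      rw [vonMisesExp_const_mul]; ring
    rw [e']
    exact vonMisesExp_mono (by fun_prop) (by fun_prop) fun θ _ => by
      linarith [(abs_le.mp (hb θ)).1]
  · rw [← vonMisesExp_const_mul]
    exact vonMisesExp_mono (by fun_prop) (by fun_prop) fun θ _ => (abs_le.mp (hb θ)).2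

/-- The central limit theorem for triangular arrays of von Mises variables with concentration
`κ N → ∞`, in terms of characteristic functions. -/
lemma tendsto_vonMisesChar_pow {κ s : ℕ → ℝ} {v : ℝ} (hκ : Tendsto κ atTop atTop)
    (hs : Tendsto (fun N : ℕ => N * s N ^ 2 / κ N) atTop (𝓝 v)) :
    Tendsto (fun N => vonMisesChar (κ N) (s N) ^ N) atTop (𝓝 (Real.exp (-v / 2))) := by
  obtain ⟨C, hC0, hC⟩ := exists_vonMisesExp_fourth_le
  have hmain : Tendsto (fun N : ℕ => -(N * s N ^ 2 / κ N) / 2 *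
      (κ N * vonMisesExp (κ N) (fun θ => θ ^ 2))) atTop (𝓝 (-v / 2)) := by
    simpa using (hs.neg.div_const 2).mul (tendsto_vonMisesExp_sq.comp hκ)
  have herr : Tendsto (fun N : ℕ => N * (vonMisesChar (κ N) (s N) - 1) - -(N * s N ^ 2 / κ N) / 2 *
      (κ N * vonMisesExp (κ N) (fun θ => θ ^ 2))) atTop (𝓝 0) := by
    have h0 : Tendsto (fun N : ℕ => C * (N * s N ^ 2 / κ N) ^ 2 / N) atTop (𝓝 0) :=
      ((hs.pow 2).const_mul C).div_atTop tendsto_natCast_atTop_atTop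
    refine squeeze_zero_norm' ?_ h0
    filter_upwards [hκ.eventually_ge_atTop 1, eventually_gt_atTop 0] with N hN hN0
    have hk : 0 < κ N := by linarith
    have hNr : (0 : ℝ) < N := by exact_mod_cast hN0
    have e : N * (vonMisesChar (κ N) (s N) - 1) - -(N * s N ^ 2 / κ N) / 2 *
        (κ N * vonMisesExp (κ N) (fun θ => θ ^ 2)) = N * (vonMisesChar (κ N) (s N)
          - (1 - s N ^ 2 / 2 * vonMisesExp (κ N) (fun θ => θ ^ 2))) := by
      field_simp
      ring
    rw [e, Real.norm_eq_abs, abs_mul, abs_of_pos hNr]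
    calc N * |vonMisesChar (κ N) (s N) - (1 - s N ^ 2 / 2 * vonMisesExp (κ N) (fun θ => θ ^ 2))|
        ≤ N * (s N ^ 4 * vonMisesExp (κ N) (fun θ => θ ^ 4)) := by
          gcongr; exact abs_vonMisesChar_sub_le _ _
      _ = (κ N ^ 2 * vonMisesExp (κ N) (fun θ => θ ^ 4)) * (N * s N ^ 2 / κ N) ^ 2 / N := by
          field_simp
      _ ≤ _ := by gcongr; exact hC _ hN
  have h := Real.tendsto_one_add_pow_exp_of_tendsto (g := fun N => vonMisesChar (κ N) (s N) - 1)
    (t := -v / 2) (by simpa using herr.add hmain)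
  simpa using h

/-! ### Asymptotics of the trace -/

/-- The trace of the `N`-th power of the transfer operator, twisted by `s` and normalized by the
von Mises mass: its eigenvalues are the values of `vonMisesChar κ` on the coset `s + ℤ`. -/
def transferTrace (κ : ℝ) (N : ℕ) (s : ℝ) : ℝ := ∑' m : ℤ, vonMisesChar κ (s + m) ^ N

/-- When `κ / N → 0` only the leading eigenvalue contributes to the trace. -/
lemma tendsto_transferTrace {κ : ℕ → ℝ} (hκ : Tendsto κ atTop atTop)
    (hκN : Tendsto (fun N : ℕ => κ N / N) atTop (𝓝 0)) (t : ℝ) :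
    Tendsto (fun N : ℕ => transferTrace (κ N) N (t * √(κ N / N))) atTop
      (𝓝 (Real.exp (-t ^ 2 / 2))) := by
  set s : ℕ → ℝ := fun N => t * √(κ N / N) with hs
  have hs0 : Tendsto s atTop (𝓝 0) := by
    have := (Real.continuous_sqrt.tendsto 0).comp hκN
    have h := this.const_mul t
    rw [Real.sqrt_zero, mul_zero] at h
    exact h
  have hsum : Summable fun m : ℤ => if m = 0 then (1 : ℝ) else 48 * (1 / (m : ℝ) ^ 2) := by
    have h := ((Real.summable_one_div_int_pow (p := 2)).mpr (by norm_num)).mul_left (48 : ℝ)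
    refine (summable_congr_cofinite ?_).mpr h
    filter_upwards [(Set.finite_singleton (0 : ℤ)).compl_mem_cofinite] with m hm
    rw [if_neg (by simpa using hm)]
  have htail : ∀ᶠ N : ℕ in atTop, ∀ m : ℤ, m ≠ 0 →
      |vonMisesChar (κ N) (s N + m)| ^ N ≤ κ N / N * (48 * (1 / (m : ℝ) ^ 2)) := by
    filter_upwards [hκ.eventually_ge_atTop 2, eventually_ge_atTop 2,
      (hs0.abs.eventually_le_const (u := 1 / 2) (by norm_num))] with N hk hN hsN m hm
    have hm1 : (1 : ℝ) ≤ |(m : ℝ)| := by exact_mod_cast Int.one_le_abs hm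
    have hξ : |(m : ℝ)| / 2 ≤ |s N + m| := by
      have := abs_sub_abs_le_abs_sub (m : ℝ) (-s N)
      rw [abs_neg, sub_neg_eq_add, add_comm] at this
      linarith
    have hNr : (0 : ℝ) < N := by exact_mod_cast (by omega : 0 < N)
    have hk0 : 0 < κ N := by linarith
    have hm0 : 0 < (m : ℝ) ^ 2 := by positivity
    have hξ2 : (m : ℝ) ^ 2 / 4 ≤ (s N + m) ^ 2 := by
      rw [← sq_abs, ← sq_abs (s N + m)]
      nlinarith
    calc |vonMisesChar (κ N) (s N + m)| ^ N
        ≤ 1 / (1 + N * (s N + m) ^ 2 / (12 * κ N)) := abs_vonMisesChar_pow_le hk (by linarith) hN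
      _ ≤ 1 / (N * ((m : ℝ) ^ 2 / 4) / (12 * κ N)) := by
          gcongr
          have : N * ((m : ℝ) ^ 2 / 4) / (12 * κ N) ≤ N * (s N + m) ^ 2 / (12 * κ N) := by gcongr
          linarith
      _ = κ N / N * (48 * (1 / (m : ℝ) ^ 2)) := by field_simp; norm_num
  have h := tendsto_tsum_of_dominated_convergence (𝓕 := atTop)
    (f := fun (N : ℕ) (m : ℤ) => vonMisesChar (κ N) (s N + m) ^ N)
    (g := fun m : ℤ => if m = 0 then Real.exp (-t ^ 2 / 2) else 0) hsum ?_ ?_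
  · rw [tsum_ite_eq] at h
    exact h
  · intro m
    by_cases hm : m = 0
    · subst hm
      rw [if_pos rfl]
      simp only [Int.cast_zero, add_zero]
      refine tendsto_vonMisesChar_pow hκ ?_
      refine tendsto_const_nhds.congr' ?_
      filter_upwards [hκ.eventually_ge_atTop 1, eventually_gt_atTop 0] with N hk hN
      have hNr : (0 : ℝ) < N := by exact_mod_cast hN
      have hk0 : 0 < κ N := by linarith
      rw [hs]
      simp only
      rw [mul_pow, Real.sq_sqrt (by positivity)]
      field_simp
    · rw [if_neg hm]
      refine squeeze_zero_norm' ?_ (by simpa using hκN.mul_const (48 * (1 / (m : ℝ) ^ 2)))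
      filter_upwards [htail] with N hN
      rw [norm_pow, Real.norm_eq_abs]
      exact hN m hm
  · filter_upwards [htail, hκN.eventually_le_const (u := 1) (by norm_num)] with N hN hN1 m
    rw [norm_pow, Real.norm_eq_abs]
    by_cases hm : m = 0
    · rw [if_pos hm]
      exact pow_le_one₀ (abs_nonneg _) (abs_vonMisesChar_le_one _ _)
    · rw [if_neg hm]
      refine (hN m hm).trans (mul_le_of_le_one_left (by positivity) hN1)

lemma integral_comp_floor {g : ℤ → ℝ} (hg : Integrable fun y : ℝ => g ⌊y⌋) :
    ∫ y : ℝ, g ⌊y⌋ = ∑' m : ℤ, g m := by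
  have h := hasSum_integral_iUnion (μ := volume) (s := fun m : ℤ => Set.Ico (m : ℝ) (m + 1))
    (f := fun y : ℝ => g ⌊y⌋) (fun _ => measurableSet_Ico) (Set.pairwise_disjoint_Ico_intCast ℝ)
    hg.integrableOn
  rw [iUnion_Ico_intCast, setIntegral_univ] at h
  rw [← h.tsum_eq]
  refine tsum_congr fun m => ?_
  rw [setIntegral_congr_fun (g := fun _ => g m) measurableSet_Ico fun y hy => ?_]
  · simp
  · simp only [Int.floor_eq_on_Ico m y hy]

/-- When `κ / N → ∞` the trace is a Riemann sum, of mesh `√(N / κ)`, of the Gaussian integral. -/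
lemma tendsto_integral_vonMisesChar_floor {κ : ℕ → ℝ} (hκ : Tendsto κ atTop atTop)
    (hκN : Tendsto (fun N : ℕ => κ N / N) atTop atTop) (s : ℝ) :
    Tendsto (fun N : ℕ => ∫ u : ℝ, vonMisesChar (κ N) (s + ⌊√(κ N / N) * u⌋) ^ N) atTop
      (𝓝 (∫ u : ℝ, Real.exp (-u ^ 2 / 2))) ∧
    ∀ᶠ N : ℕ in atTop,
      Integrable fun u : ℝ => vonMisesChar (κ N) (s + ⌊√(κ N / N) * u⌋) ^ N := by
  set r : ℕ → ℝ := fun N => √(κ N / N) with hr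
  have hrt : Tendsto r atTop atTop := Real.tendsto_sqrt_atTop.comp hκN
  have hmeas : ∀ N : ℕ, AEStronglyMeasurable
      (fun u : ℝ => vonMisesChar (κ N) (s + ⌊r N * u⌋) ^ N) volume := fun N => by
    have h1 : Measurable fun m : ℤ => vonMisesChar (κ N) (s + m) ^ N := measurable_of_countable _
    exact (h1.comp (Int.measurable_floor.comp (measurable_const_mul (r N)))).aestronglyMeasurable
  have hfloor : ∀ N u, |(s + ⌊r N * u⌋) - r N * u| ≤ |s| + 1 := fun N u => by
    have h1 := Int.floor_le (r N * u)
    have h2 := Int.lt_floor_add_one (r N * u)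
    have h3 := abs_le.mp (le_refl |s|)
    rw [abs_le]
    constructor <;> linarith [h3.1, h3.2]
  have hbound : ∀ᶠ N : ℕ in atTop, ∀ u : ℝ,
      ‖vonMisesChar (κ N) (s + ⌊r N * u⌋) ^ N‖ ≤ 48 * (1 + u ^ 2)⁻¹ := by
    filter_upwards [hκ.eventually_ge_atTop 2, eventually_ge_atTop 2,
      hrt.eventually_ge_atTop (2 * (|s| + 1))] with N hk hN hrN u
    have hNr : (0 : ℝ) < N := by exact_mod_cast (by omega : 0 < N)
    have hk0 : 0 < κ N := by linarith
    have hs0 := abs_nonneg s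
    rw [norm_pow, Real.norm_eq_abs, ← div_eq_mul_inv]
    rcases le_total 1 |u| with hu | hu
    · set ξ := s + ⌊r N * u⌋ with hξ
      have h1 : r N * |u| / 2 ≤ |ξ| := by
        have h2 := abs_sub_abs_le_abs_sub (r N * u) ξ
        rw [abs_sub_comm, abs_mul, abs_of_nonneg (by linarith : 0 ≤ r N)] at h2
        have h3 := hfloor N u
        nlinarith
      have h4 : κ N / N * u ^ 2 / 4 ≤ ξ ^ 2 := by
        have h5 : r N ^ 2 = κ N / N := Real.sq_sqrt (by positivity)
        rw [← h5, ← sq_abs u, ← sq_abs ξ]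
        have h6 : 0 ≤ r N * |u| / 2 := by positivity
        nlinarith
      calc |vonMisesChar (κ N) ξ| ^ N ≤ 1 / (1 + N * ξ ^ 2 / (12 * κ N)) :=
            abs_vonMisesChar_pow_le hk (by nlinarith) hN
        _ ≤ 1 / (1 + N * (κ N / N * u ^ 2 / 4) / (12 * κ N)) := by gcongr
        _ = 48 / (48 + u ^ 2) := by field_simp; norm_num; ring
        _ ≤ 48 / (1 + u ^ 2) := by gcongr; norm_num
    · have h1 : u ^ 2 ≤ 1 := by rw [← sq_abs]; nlinarith [abs_nonneg u]
      refine (pow_le_one₀ (abs_nonneg _) (abs_vonMisesChar_le_one _ _)).trans ?_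
      rw [le_div_iff₀ (by positivity)]
      linarith
  have hint : Integrable fun u : ℝ => 48 * (1 + u ^ 2)⁻¹ := integrable_inv_one_add_sq.const_mul 48
  refine ⟨tendsto_integral_filter_of_dominated_convergence _ (Eventually.of_forall hmeas)
    (hbound.mono fun N hN => Eventually.of_forall hN) hint (Eventually.of_forall fun u => ?_),
    hbound.mono fun N hN => hint.mono' (hmeas N) (Eventually.of_forall hN)⟩
  refine tendsto_vonMisesChar_pow hκ ?_
  have h1 : Tendsto (fun N => (s + ⌊r N * u⌋) / r N) atTop (𝓝 u) := by
    rw [tendsto_iff_norm_sub_tendsto_zero]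
    refine squeeze_zero' (Eventually.of_forall fun _ => norm_nonneg _) ?_
      (tendsto_const_nhds (x := |s| + 1) |>.div_atTop hrt)
    filter_upwards [hrt.eventually_gt_atTop 0] with N hN
    have e : (s + ⌊r N * u⌋) / r N - u = ((s + ⌊r N * u⌋) - r N * u) / r N := by field_simp
    rw [e, norm_div, Real.norm_eq_abs, Real.norm_eq_abs, abs_of_pos hN]
    gcongr
    exact hfloor N u
  refine (h1.pow 2).congr' ?_
  filter_upwards [hκ.eventually_ge_atTop 1, eventually_gt_atTop 0] with N hk hN
  have hNr : (0 : ℝ) < N := by exact_mod_cast hN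
  have hk0 : 0 < κ N := by linarith
  have h5 : r N ^ 2 = κ N / N := Real.sq_sqrt (by positivity)
  rw [div_pow, h5, div_div_eq_mul_div, mul_comm _ (N : ℝ)]

lemma tendsto_transferTrace_div {κ : ℕ → ℝ} (hκ : Tendsto κ atTop atTop)
    (hκN : Tendsto (fun N : ℕ => κ N / N) atTop atTop) (s : ℝ) :
    Tendsto (fun N : ℕ => transferTrace (κ N) N s / transferTrace (κ N) N 0) atTop (𝓝 1) := by
  have hI : (∫ u : ℝ, Real.exp (-u ^ 2 / 2)) ≠ 0 := by
    have e : (fun u : ℝ => Real.exp (-u ^ 2 / 2)) = fun u => Real.exp (-(1 / 2) * u ^ 2) := by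
      ext u; congr 1; ring
    rw [e, integral_gaussian]
    positivity
  have hT : ∀ s : ℝ, ∀ᶠ N : ℕ in atTop, transferTrace (κ N) N s =
      √(κ N / N) * ∫ u : ℝ, vonMisesChar (κ N) (s + ⌊√(κ N / N) * u⌋) ^ N := fun s => by
    filter_upwards [(tendsto_integral_vonMisesChar_floor hκ hκN s).2,
      hκN.eventually_gt_atTop 0] with N hN hpos
    have hr : 0 < √(κ N / N) := Real.sqrt_pos.mpr hpos
    have hint : Integrable fun y : ℝ => vonMisesChar (κ N) (s + ⌊y⌋) ^ N :=
      (integrable_comp_mul_left_iff (fun y : ℝ => vonMisesChar (κ N) (s + ⌊y⌋) ^ N) hr.ne').mp hN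
    rw [Measure.integral_comp_mul_left (fun y : ℝ => vonMisesChar (κ N) (s + ⌊y⌋) ^ N),
      integral_comp_floor (g := fun m : ℤ => vonMisesChar (κ N) (s + m) ^ N) hint,
      abs_of_pos (by positivity), smul_eq_mul, mul_inv_cancel_left₀ hr.ne', transferTrace]
  have h := (tendsto_integral_vonMisesChar_floor hκ hκN s).1.div
    (tendsto_integral_vonMisesChar_floor hκ hκN 0).1 hI
  rw [div_self hI] at h
  refine h.congr' ?_
  filter_upwards [hT s, hT 0, hκN.eventually_gt_atTop 0] with N h1 h2 hpos
  have hr : 0 < √(κ N / N) := Real.sqrt_pos.mpr hpos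
  rw [h1, h2, mul_div_mul_left _ _ hr.ne']
  rfl

/-! ### The trace formula for cyclic products on the circle -/

/-- The `(n + 1)`-fold convolution of `k` with itself, for Lebesgue measure on the circle. -/
def convPow (k : Rotor → ℂ) : ℕ → Rotor → ℂ
  | 0 => k
  | n + 1 => fun z => ∫ x, k x * convPow k n (z - x)

/-- The product of the values of `k` at the successive increments of the path that starts at `y`,
visits `x 0, …, x (n - 1)` and ends at `z`. -/
def pathWeight (k : Rotor → ℂ) : (n : ℕ) → Rotor → (Fin n → Rotor) → Rotor → ℂ
  | 0, y, _, z => k (z - y)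
  | n + 1, y, x, z => k (x 0 - y) * pathWeight k n (x 0) (Fin.tail x) z

/-- The Fourier coefficient for Lebesgue measure of total mass `2π`, not the normalized one. -/
def circleCoeff (f : Rotor → ℂ) (m : ℤ) : ℂ := ∫ x, fourier (-m) x * f x

lemma circleCoeff_eq (f : Rotor → ℂ) (m : ℤ) :
    circleCoeff f m = (2 * Real.pi : ℝ) * fourierCoeff f m := by
  unfold circleCoeff fourierCoeff
  rw [AddCircle.integral_haarAddCircle]
  simp only [smul_eq_mul, Complex.real_smul]
  rw [← mul_assoc, ← Complex.ofReal_mul, mul_inv_cancel₀ Real.two_pi_pos.ne', Complex.ofReal_one,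
    one_mul]

section TraceFormula

variable {k : Rotor → ℂ}

lemma measurable_convPow (hk : Measurable k) (n : ℕ) : Measurable (convPow k n) := by
  induction n with
  | zero => exact hk
  | succ n ih =>
    have h : StronglyMeasurable fun p : Rotor × Rotor => k p.2 * convPow k n (p.1 - p.2) :=
      ((hk.comp measurable_snd).mul
        (ih.comp (measurable_fst.sub measurable_snd))).stronglyMeasurable
    exact h.integral_prod_right.measurable

lemma norm_convPow_le {C : ℝ} (hC : ∀ x, ‖k x‖ ≤ C) (n : ℕ) :
    ∃ D, ∀ x, ‖convPow k n x‖ ≤ D := by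
  have hC0 : 0 ≤ C := (norm_nonneg _).trans (hC 0)
  induction n with
  | zero => exact ⟨C, hC⟩
  | succ n ih =>
    obtain ⟨D, hD⟩ := ih
    refine ⟨C * D * volume.real (Set.univ : Set Rotor), fun z => ?_⟩
    refine norm_integral_le_of_norm_le_const (Eventually.of_forall fun x => ?_)
    rw [norm_mul]
    exact mul_le_mul (hC x) (hD _) (norm_nonneg _) hC0

lemma measurable_pathWeight (hk : Measurable k) (n : ℕ) (z : Rotor) :
    Measurable fun p : Rotor × (Fin n → Rotor) => pathWeight k n p.1 p.2 z := by
  induction n with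
  | zero => exact hk.comp (measurable_fst.const_sub z)
  | succ n ih =>
    have h0 : Measurable fun p : Rotor × (Fin (n + 1) → Rotor) => p.2 0 :=
      (measurable_pi_apply 0).comp measurable_snd
    have ht : Measurable fun p : Rotor × (Fin (n + 1) → Rotor) => Fin.tail p.2 :=
      measurable_pi_lambda _ fun i => (measurable_pi_apply i.succ).comp measurable_snd
    exact (hk.comp (h0.sub measurable_fst)).mul (ih.comp (h0.prodMk ht))

lemma norm_pathWeight_le {C : ℝ} (hC : ∀ x, ‖k x‖ ≤ C) (n : ℕ) (y : Rotor) (x : Fin n → Rotor)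
    (z : Rotor) : ‖pathWeight k n y x z‖ ≤ C ^ (n + 1) := by
  have hC0 : 0 ≤ C := (norm_nonneg _).trans (hC 0)
  induction n generalizing y with
  | zero =>
    rw [zero_add, pow_one]
    exact hC (z - y)
  | succ n ih =>
    rw [pathWeight, norm_mul, pow_succ']
    exact mul_le_mul (hC _) (ih _ _) (norm_nonneg _) hC0

lemma integral_fin_succ {n : ℕ} {f : (Fin (n + 1) → Rotor) → ℂ} (hf : Measurable f) {C : ℝ}
    (hC : ∀ x, ‖f x‖ ≤ C) :
    ∫ x, f x = ∫ a : Rotor, ∫ x : Fin n → Rotor, f (Fin.cons a x) := by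
  have hmp := (volume_preserving_piFinSuccAbove (fun _ : Fin (n + 1) => Rotor) 0).symm
  rw [← hmp.integral_comp', Measure.volume_eq_prod, integral_prod]
  · simp only [MeasurableEquiv.piFinSuccAbove_symm_apply, Fin.insertNthEquiv, Equiv.coe_fn_mk,
      Fin.insertNth_zero]
    rfl
  · exact Integrable.of_bound (hf.comp (MeasurableEquiv.measurable _)).aestronglyMeasurable C
      (Eventually.of_forall fun x => hC _)

lemma integral_pathWeight (hk : Measurable k) {C : ℝ} (hC : ∀ x, ‖k x‖ ≤ C) (n : ℕ) (y z : Rotor) :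
    ∫ x, pathWeight k n y x z = convPow k n (z - y) := by
  induction n generalizing y with
  | zero => simp [pathWeight, convPow, volume_pi, Measure.real]
  | succ n ih =>
    have hm : Measurable fun x : Fin (n + 1) → Rotor => pathWeight k (n + 1) y x z :=
      (measurable_pathWeight hk (n + 1) z).comp measurable_prodMk_left
    rw [integral_fin_succ hm (norm_pathWeight_le hC (n + 1) y · z)]
    simp only [pathWeight, Fin.cons_zero, Fin.tail_cons, integral_const_mul, ih]
    change _ = ∫ x, k x * convPow k n (z - y - x)
    conv_rhs => rw [← integral_sub_right_eq_self _ y]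
    simp only [sub_sub_sub_cancel_right]

lemma prod_snoc_sub_cons (k : Rotor → ℂ) (n : ℕ) (y : Rotor) (x : Fin n → Rotor) (z : Rotor) :
    ∏ i : Fin (n + 1), k ((Fin.snoc x z : Fin (n + 1) → Rotor) i -
      (Fin.cons y x : Fin (n + 1) → Rotor) i) = pathWeight k n y x z := by
  induction n generalizing y with
  | zero => simp [pathWeight, Fin.snoc]
  | succ n ih =>
    induction x using Fin.consCases with
    | _ a q =>
      rw [Fin.prod_univ_succ, ← Fin.cons_snoc_eq_snoc_cons]
      simp only [Fin.cons_zero, Fin.cons_succ, pathWeight, Fin.tail_cons]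
      rw [ih]

lemma prod_increment (k : Rotor → ℂ) {n : ℕ} (a : Rotor) (x : Fin n → Rotor) :
    ∏ i, k (increment (Fin.cons a x : Config (n + 1)) i) = pathWeight k n a x a := by
  rw [← prod_snoc_sub_cons, ← Equiv.prod_comp (finRotate (n + 1))]
  refine Finset.prod_congr rfl fun i _ => ?_
  rw [increment, Equiv.symm_apply_apply, Fin.snoc_eq_cons_rotate]

lemma circleCoeff_convPow (hk : Measurable k) {C : ℝ} (hC : ∀ x, ‖k x‖ ≤ C) (n : ℕ) (m : ℤ) :
    circleCoeff (convPow k n) m = circleCoeff k m ^ (n + 1) := by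
  induction n with
  | zero => simp [convPow]
  | succ n ih =>
    obtain ⟨D, hD⟩ := norm_convPow_le hC n
    have hC0 : 0 ≤ C := (norm_nonneg _).trans (hC 0)
    have hcm := measurable_convPow hk n
    have hfm : Measurable fun x : Rotor => fourier (-m) x := (fourier (-m)).continuous.measurable
    have hfn : ∀ x : Rotor, ‖fourier (-m) x‖ = 1 := fun x => by
      rw [fourier_apply]
      exact Circle.norm_coe _
    have hint : Integrable (Function.uncurry fun z x : Rotor =>
        fourier (-m) z * (k x * convPow k n (z - x))) (volume.prod volume) := by
      refine Integrable.of_bound ?_ (C * D) (Eventually.of_forall fun p => ?_)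
      · exact ((hfm.comp measurable_fst).mul ((hk.comp measurable_snd).mul
          (hcm.comp (measurable_fst.sub measurable_snd)))).aestronglyMeasurable
      · rw [Function.uncurry, norm_mul, norm_mul, hfn, one_mul]
        exact mul_le_mul (hC _) (hD _) (norm_nonneg _) hC0
    have hswap := integral_integral_swap hint
    unfold circleCoeff at ih ⊢
    simp only [convPow, ← integral_const_mul]
    rw [hswap, pow_succ, ← ih, ← integral_const_mul]
    refine integral_congr_ae (Eventually.of_forall fun x => ?_)
    simp only
    rw [← integral_add_right_eq_self _ x, ← integral_mul_const]
    refine integral_congr_ae (Eventually.of_forall fun z => ?_)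
    simp only [add_sub_cancel_right]
    have : (fourier (-m) (z + x) : ℂ) = fourier (-m) z * fourier (-m) x := by
      simp only [fourier_apply, smul_add, AddCircle.toCircle_add, Circle.coe_mul]
    rw [this]
    ring

/-- Parseval's identity for the value at `0` of a convolution. -/
lemma hasSum_circleCoeff_mul {f g : Rotor → ℂ} (hf : Measurable f) (hg : Measurable g) {C D : ℝ}
    (hC : ∀ x, ‖f x‖ ≤ C) (hD : ∀ x, ‖g x‖ ≤ D) :
    HasSum (fun m => circleCoeff f m * circleCoeff g m)
      ((2 * Real.pi : ℝ) * ∫ x, f x * g (-x)) := by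
  set u : Rotor → ℂ := fun x => (starRingEnd ℂ) (g (-x)) with hu
  have hfL : MemLp f 2 (AddCircle.haarAddCircle (T := 2 * Real.pi)) :=
    MemLp.of_bound hf.aestronglyMeasurable C (Eventually.of_forall hC)
  have huL : MemLp u 2 (AddCircle.haarAddCircle (T := 2 * Real.pi)) :=
    MemLp.of_bound (Complex.continuous_conj.measurable.comp
      (hg.comp measurable_neg)).aestronglyMeasurable D
      (Eventually.of_forall fun x => by simpa [hu] using hD (-x))
  have hb : ∀ (h : Rotor → ℂ) (hh : MemLp h 2 (AddCircle.haarAddCircle (T := 2 * Real.pi))) (m : ℤ),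
      inner ℂ (fourierBasis m) (hh.toLp h) = fourierCoeff h m := fun h hh m => by
    rw [← HilbertBasis.repr_apply_apply, fourierBasis_repr, fourierCoeff_congr_ae hh.coeFn_toLp]
  have hcu : ∀ m, (starRingEnd ℂ) (fourierCoeff u m) = fourierCoeff g m := fun m => by
    unfold fourierCoeff
    rw [← integral_conj, ← integral_neg_eq_self]
    refine integral_congr_ae (Eventually.of_forall fun x => ?_)
    simp only [hu, smul_eq_mul, map_mul, neg_neg, Complex.conj_conj]
    congr 1
    rw [← fourier_neg, neg_neg, fourier_apply, fourier_apply, smul_neg, neg_smul]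
  have h := fourierBasis.hasSum_inner_mul_inner (huL.toLp u) (hfL.toLp f)
  have hi : inner ℂ (huL.toLp u) (hfL.toLp f) =
      ((2 * Real.pi)⁻¹ : ℝ) * ∫ x, f x * g (-x) := by
    rw [L2.inner_def, ← Complex.real_smul, ← AddCircle.integral_haarAddCircle]
    refine integral_congr_ae ?_
    filter_upwards [huL.coeFn_toLp, hfL.coeFn_toLp] with x h1 h2
    rw [h1, h2, RCLike.inner_apply', hu]
    simp [mul_comm]
  rw [hi] at h
  have h2 := h.mul_left (((2 * Real.pi : ℝ) : ℂ) ^ 2)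
  have hpi : ((2 * Real.pi : ℝ) : ℂ) ≠ 0 := by exact_mod_cast Real.two_pi_pos.ne'
  convert! h2 using 1
  · ext m
    rw [hb, ← inner_conj_symm, hb, hcu, circleCoeff_eq, circleCoeff_eq]
    ring
  · rw [Complex.ofReal_inv, ← mul_assoc, pow_two, mul_inv_cancel_right₀ hpi]

/-- The integral over all cyclic configurations of a product of functions of the increments is the
trace of a power of a convolution operator, that is, a power sum of Fourier coefficients. -/
lemma hasSum_circleCoeff_pow (hk : Measurable k) {C : ℝ} (hC : ∀ x, ‖k x‖ ≤ C) {N : ℕ}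
    (hN : 2 ≤ N) :
    HasSum (fun m => circleCoeff k m ^ N) (∫ x : Config N, ∏ i, k (increment x i)) := by
  obtain ⟨n, rfl⟩ : ∃ n, N = n + 2 := ⟨N - 2, by omega⟩
  obtain ⟨D, hD⟩ := norm_convPow_le hC n
  have hC0 : 0 ≤ C := (norm_nonneg _).trans (hC 0)
  have h := hasSum_circleCoeff_mul hk (measurable_convPow hk n) hC hD
  have hm : Measurable fun x : Config (n + 2) => ∏ i, k (increment x i) :=
    Finset.measurable_fun_prod _ fun i _ =>
      hk.comp ((measurable_pi_apply i).sub (measurable_pi_apply _))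
  have hb : ∀ x : Config (n + 2), ‖∏ i, k (increment x i)‖ ≤ C ^ (n + 2) := fun x => by
    rw [norm_prod]
    refine (Finset.prod_le_prod (fun _ _ => norm_nonneg _) fun i _ => hC _).trans ?_
    simp
  rw [integral_fin_succ hm hb]
  simp only [prod_increment, integral_pathWeight hk hC, sub_self, integral_const]
  convert! h using 1
  · ext m
    rw [circleCoeff_convPow hk hC, ← pow_succ']
  · rw [Complex.real_smul, convPow]
    simp [Measure.real, AddCircle.measure_univ, Real.pi_pos.le]

end TraceFormula

/-! ### The characteristic function of the winding number -/

lemma rep_coe {θ : ℝ} (hθ : θ ∈ Set.Ioc (-Real.pi) Real.pi) : rep (θ : Rotor) = θ :=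
  AddCircle.equivIoc_coe_of_mem
    (by rwa [show -Real.pi + 2 * Real.pi = Real.pi by ring])

lemma coe_rep (θ : Rotor) : ((rep θ : ℝ) : Rotor) = θ := AddCircle.coe_equivIoc

lemma measurable_rep : Measurable rep :=
  measurable_subtype_coe.comp (AddCircle.measurableEquivIoc (2 * Real.pi) (-Real.pi)).measurable

lemma cosine_coe (θ : ℝ) : cosine (θ : Rotor) = Real.cos θ := rfl

lemma measurable_increment {N : ℕ} (i : Fin N) : Measurable fun x : Config N => increment x i :=
  (measurable_pi_apply i).sub (measurable_pi_apply _)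

lemma measurable_windingNumber (N : ℕ) : Measurable (windingNumber : Config N → ℝ) :=
  (Finset.measurable_fun_sum _ fun i _ =>
    measurable_rep.comp (measurable_increment i)).const_mul _

/-- The kernel of the transfer operator, twisted by the character `exp (i s θ)` of the lifted
angle. For non-integral `s` it is discontinuous at the antipode. -/
def twistedKernel (κ s : ℝ) (θ : Rotor) : ℂ :=
  Complex.exp (κ * cosine θ) * Complex.exp (s * rep θ * Complex.I)

lemma measurable_twistedKernel (κ s : ℝ) : Measurable (twistedKernel κ s) := by
  have h1 := continuous_cosine.measurable
  have h2 := measurable_rep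
  unfold twistedKernel
  fun_prop

lemma abs_cosine_le_one (θ : Rotor) : |cosine θ| ≤ 1 := by
  induction θ using QuotientAddGroup.induction_on with
  | H t => exact Real.abs_cos_le_one t

lemma norm_twistedKernel_le (κ s : ℝ) (θ : Rotor) : ‖twistedKernel κ s θ‖ ≤ Real.exp |κ| := by
  unfold twistedKernel
  rw [norm_mul, ← Complex.ofReal_mul, ← Complex.ofReal_mul, Complex.norm_exp_ofReal_mul_I, mul_one,
    ← Complex.ofReal_exp, Complex.norm_real, Real.norm_eq_abs, Real.abs_exp, Real.exp_le_exp]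
  calc κ * cosine θ ≤ |κ * cosine θ| := le_abs_self _
    _ = |κ| * |cosine θ| := abs_mul _ _
    _ ≤ |κ| := mul_le_of_le_one_right (abs_nonneg _) (abs_cosine_le_one θ)

lemma circleCoeff_twistedKernel (κ s : ℝ) (m : ℤ) :
    circleCoeff (twistedKernel κ s) m = ((vonMisesMass κ * vonMisesChar κ (s - m) : ℝ) : ℂ) := by
  set w : ℝ → ℂ := fun θ => Complex.exp (((s - m : ℝ) : ℂ) * θ * Complex.I) *
    (Real.exp (κ * Real.cos θ) : ℝ) with hw
  have hA : circleCoeff (twistedKernel κ s) m = ∫ θ in (-Real.pi)..Real.pi, w θ := by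
    unfold circleCoeff
    rw [← AddCircle.intervalIntegral_preimage (2 * Real.pi) (-Real.pi),
      show -Real.pi + 2 * Real.pi = Real.pi by ring]
    refine intervalIntegral.integral_congr_ae (Eventually.of_forall fun θ hθ => ?_)
    rw [Set.uIoc_of_le (by linarith [Real.pi_pos])] at hθ
    rw [fourier_coe_apply, twistedKernel, rep_coe hθ, cosine_coe, hw]
    simp only
    rw [Complex.ofReal_exp, Complex.ofReal_mul, mul_left_comm, ← Complex.exp_add, mul_comm]
    congr 2
    · have hpi : (Real.pi : ℂ) ≠ 0 := by exact_mod_cast Real.pi_ne_zero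
      push_cast
      field_simp
      ring
    · push_cast
      rfl
  have hB : (∫ θ in (-Real.pi)..Real.pi, w (-θ)) = ∫ θ in (-Real.pi)..Real.pi, w θ := by
    rw [intervalIntegral.integral_comp_neg, neg_neg]
  have hwc : Continuous w := by
    rw [hw]; fun_prop
  -- averaging over `θ ↦ -θ` leaves only the cosine
  have h2 : (2 : ℂ) * ∫ θ in (-Real.pi)..Real.pi, w θ = 2 * ∫ θ in (-Real.pi)..Real.pi,
      ((Real.cos ((s - m) * θ) * Real.exp (κ * Real.cos θ) : ℝ) : ℂ) := by
    rw [two_mul]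
    nth_rewrite 2 [← hB]
    rw [← intervalIntegral.integral_add (hwc.intervalIntegrable _ _)
      (Continuous.intervalIntegrable (by fun_prop) _ _), ← intervalIntegral.integral_const_mul]
    refine intervalIntegral.integral_congr fun θ _ => ?_
    simp only [hw, Real.cos_neg]
    rw [← add_mul, Complex.ofReal_mul, ← mul_assoc, Complex.ofReal_cos, Complex.two_cos]
    push_cast
    congr 3
    ring_nf
  rw [hA, mul_left_cancel₀ two_ne_zero h2, intervalIntegral.integral_ofReal, vonMisesChar,
    vonMisesExp, mul_div_cancel₀ _ (vonMisesMass_pos κ).ne']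

lemma integral_prod_twistedKernel (κ s : ℝ) {N : ℕ} (hN : 2 ≤ N) :
    ∫ x : Config N, ∏ i, twistedKernel κ s (increment x i) =
      ((vonMisesMass κ ^ N * transferTrace κ N s : ℝ) : ℂ) := by
  have h := hasSum_circleCoeff_pow (measurable_twistedKernel κ s) (norm_twistedKernel_le κ s) hN
  rw [← h.tsum_eq, transferTrace, ← (Equiv.neg ℤ).tsum_eq, ← tsum_mul_left, Complex.ofReal_tsum]
  refine tsum_congr fun m => ?_
  simp [circleCoeff_twistedKernel, mul_pow]

lemma prod_twistedKernel (κ s : ℝ) {N : ℕ} (x : Config N) :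
    ∏ i, twistedKernel κ s (increment x i) =
      (Real.exp (κ * ∑ i, cosine (increment x i)) : ℝ) *
        Complex.exp (s * (∑ i, rep (increment x i) : ℝ) * Complex.I) := by
  simp only [twistedKernel, Finset.prod_mul_distrib, ← Complex.exp_sum]
  rw [Complex.ofReal_exp]
  push_cast
  rw [Finset.mul_sum, Finset.mul_sum, Finset.sum_mul]

/-- The characteristic function of the sum of the lifted increments, that is, of `2π` times the
winding number, as a ratio of traces. The factors `vonMisesMass κ ^ N` cancel. -/
lemma integral_gibbs_exp (J σ s : ℝ) {N : ℕ} (hN : 2 ≤ N) :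
    ∫ x, Complex.exp (s * (∑ i, rep (increment x i) : ℝ) * Complex.I) ∂gibbs J σ N =
      ((transferTrace (J / (2 * σ ^ 2)) N s / transferTrace (J / (2 * σ ^ 2)) N 0 : ℝ) : ℂ) := by
  set κ := J / (2 * σ ^ 2) with hκ
  have he : ∀ x : Config N, -(1 / (2 * σ ^ 2)) * hamiltonian J x =
      κ * ∑ i, cosine (increment x i) := fun x => by
    rw [hamiltonian, hκ]; ring
  have h0 : ((∫ x : Config N, Real.exp (κ * ∑ i, cosine (increment x i)) : ℝ) : ℂ) =
      ((vonMisesMass κ ^ N * transferTrace κ N 0 : ℝ) : ℂ) := by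
    rw [← integral_prod_twistedKernel κ 0 hN, ← integral_complex_ofReal]
    simp only [prod_twistedKernel]
    simp
  have h0' := Complex.ofReal_injective h0
  rw [gibbs, integral_tilted]
  simp only [he, h0', Complex.real_smul]
  have h1 := integral_prod_twistedKernel κ s hN
  simp only [prod_twistedKernel] at h1
  have hZ : vonMisesMass κ ^ N ≠ 0 := (pow_pos (vonMisesMass_pos κ) N).ne'
  calc ∫ x : Config N, (((Real.exp (κ * ∑ i, cosine (increment x i)) /
          (vonMisesMass κ ^ N * transferTrace κ N 0) : ℝ) : ℂ)) *
          Complex.exp (s * (∑ i, rep (increment x i) : ℝ) * Complex.I)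
      = ∫ x : Config N, (((vonMisesMass κ ^ N * transferTrace κ N 0)⁻¹ : ℝ) : ℂ) *
          ((Real.exp (κ * ∑ i, cosine (increment x i)) : ℝ) *
          Complex.exp (s * (∑ i, rep (increment x i) : ℝ) * Complex.I)) := by
        refine integral_congr_ae (Eventually.of_forall fun x => ?_)
        simp only
        rw [div_eq_mul_inv, Complex.ofReal_mul]
        ring
    _ = _ := by
        rw [integral_const_mul, h1, ← Complex.ofReal_mul, ← div_eq_inv_mul,
          mul_div_mul_left _ _ hZ]

lemma charFun_map_gibbs (J σ c t : ℝ) {N : ℕ} (hN : 2 ≤ N) :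
    charFun ((gibbs J σ N).map fun x => c * ∑ i, rep (increment x i)) t =
      ((transferTrace (J / (2 * σ ^ 2)) N (t * c) /
        transferTrace (J / (2 * σ ^ 2)) N 0 : ℝ) : ℂ) := by
  have hm : Measurable fun x : Config N => c * ∑ i, rep (increment x i) :=
    (Finset.measurable_fun_sum _ fun i _ =>
      measurable_rep.comp (measurable_increment i)).const_mul _
  rw [charFun_apply_real, integral_map hm.aemeasurable (by fun_prop), ← integral_gibbs_exp J σ _ hN]
  refine integral_congr_ae (Eventually.of_forall fun x => ?_)
  simp only
  push_cast
  congr 2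
  ring

/-! ### The two regimes -/

lemma exists_int_windingNumber {N : ℕ} (x : Config N) : ∃ n : ℤ, windingNumber x = n := by
  have h : ((∑ i, rep (increment x i) : ℝ) : Rotor) = 0 := by
    have h1 : ((∑ i, rep (increment x i) : ℝ) : Rotor) = ∑ i, increment x i :=
      (map_sum (QuotientAddGroup.mk' (AddSubgroup.zmultiples (2 * Real.pi))) _ _).trans
        (Finset.sum_congr rfl fun i _ => coe_rep _)
    rw [h1]
    simp only [increment, Finset.sum_sub_distrib]
    rw [Equiv.sum_comp, sub_self]
  obtain ⟨n, hn⟩ := (AddCircle.coe_eq_zero_iff (2 * Real.pi)).mp h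
  refine ⟨n, ?_⟩
  rw [windingNumber, ← hn, zsmul_eq_mul]
  field_simp

/-- For at least two rotors, an increment is diffuse given all rotors but one of the two in it. -/
lemma ae_windingDefined (J σ : ℝ) {N : ℕ} (hN : 2 ≤ N) : ∀ᵐ x ∂gibbs J σ N, WindingDefined x := by
  refine (tilted_absolutelyContinuous _ _).ae_le ?_
  change ∀ᵐ x : Config N, ∀ i, increment x i ≠ ((Real.pi : ℝ) : Rotor)
  rw [ae_all_iff]
  intro i
  obtain ⟨n, rfl⟩ : ∃ n, N = n + 2 := ⟨N - 2, by omega⟩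
  have hj : (finRotate (n + 2)).symm i ≠ i := by
    rw [ne_eq, Equiv.symm_apply_eq, finRotate_apply]
    simp
  obtain ⟨j, hj'⟩ := Fin.exists_succAbove_eq hj
  have hmp := volume_preserving_piFinSuccAbove (fun _ : Fin (n + 2) => Rotor) i
  have hQ : ∀ᵐ p : Rotor × (Fin (n + 1) → Rotor), p.1 - p.2 j ≠ ((Real.pi : ℝ) : Rotor) := by
    have hs : MeasurableSet {p : Rotor × (Fin (n + 1) → Rotor) |
        ¬ p.1 - p.2 j ≠ ((Real.pi : ℝ) : Rotor)} := by
      simp only [not_not]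
      exact measurableSet_eq_fun
        (measurable_fst.sub ((measurable_pi_apply j).comp measurable_snd)) measurable_const
    rw [ae_iff, Measure.volume_eq_prod, Measure.prod_apply_symm hs]
    refine lintegral_eq_zero_of_ae_eq_zero (Eventually.of_forall fun y => ?_)
    have e : (fun x => (x, y)) ⁻¹' {p : Rotor × (Fin (n + 1) → Rotor) |
        ¬ p.1 - p.2 j ≠ ((Real.pi : ℝ) : Rotor)} = {((Real.pi : ℝ) : Rotor) + y j} := by
      ext x
      simp [sub_eq_iff_eq_add]
    simp only [e]
    rw [← Metric.closedBall_zero, AddCircle.volume_closedBall]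
    simp [Real.pi_pos.le]
  filter_upwards [hmp.quasiMeasurePreserving.ae hQ] with x hx
  rw [increment, ← hj']
  exact hx

lemma sum_rep_increment {N : ℕ} (x : Config N) :
    ∑ i, rep (increment x i) = 2 * Real.pi * windingNumber x := by
  rw [windingNumber]
  field_simp

/-- The limit is obtained from the pointwise limit of the characteristic functions. -/
theorem tendstoInDistribution_windingNumber {J σ : ℕ → ℝ}
    (hJ : Tendsto (fun N => J N / σ N ^ 2) atTop atTop)
    (ho : (fun N => J N / σ N ^ 2) =o[atTop] (fun N : ℕ => (N : ℝ))) :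
    TendstoInDistribution
      (fun (N : ℕ) (x : Config N) =>
        2 * Real.pi * Real.sqrt (J N / (2 * σ N ^ 2 * N)) * windingNumber x)
      atTop (id : ℝ → ℝ) (fun N => gibbs (J N) (σ N) N) (gaussianReal 0 1) := by
  set κ : ℕ → ℝ := fun N => J N / (2 * σ N ^ 2) with hκdef
  have hκ2 : ∀ N, κ N = J N / σ N ^ 2 / 2 := fun N => by rw [hκdef]; ring
  have hκ : Tendsto κ atTop atTop := by
    simp only [funext hκ2]
    exact hJ.atTop_div_const two_pos
  have hκN : Tendsto (fun N : ℕ => κ N / N) atTop (𝓝 0) := by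
    have h := ho.tendsto_div_nhds_zero.div_const 2
    rw [zero_div] at h
    refine h.congr fun N => ?_
    rw [hκ2]; ring
  have hX : ∀ N : ℕ, (fun x : Config N =>
      2 * Real.pi * Real.sqrt (J N / (2 * σ N ^ 2 * N)) * windingNumber x) =
      fun x => √(κ N / N) * ∑ i, rep (increment x i) := fun N => by
    ext x
    rw [sum_rep_increment, hκdef, div_div]
    ring
  have hmeas : ∀ N : ℕ, AEMeasurable (fun x : Config N =>
      2 * Real.pi * Real.sqrt (J N / (2 * σ N ^ 2 * N)) * windingNumber x)
      (gibbs (J N) (σ N) N) := fun N =>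
    ((measurable_windingNumber N).const_mul _).aemeasurable
  refine ⟨hmeas, aemeasurable_id, ?_⟩
  refine ProbabilityMeasure.tendsto_iff_tendsto_charFun.mpr fun t => ?_
  simp only [ProbabilityMeasure.coe_mk, Measure.map_id, charFun_gaussianReal, hX]
  have h0 := tendsto_transferTrace hκ hκN 0
  simp only [zero_mul] at h0
  have h := (tendsto_transferTrace hκ hκN t).div h0 (Real.exp_pos _).ne'
  have h' := (Complex.continuous_ofReal.tendsto _).comp h
  refine (h'.congr' ?_).trans_eq ?_
  · filter_upwards [eventually_ge_atTop 2] with N hN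
    rw [charFun_map_gibbs _ _ _ _ hN]
    rfl
  · simp [neg_div]

/-- The characteristic function of the winding number converges to `1` pointwise, so the winding
number tends to `0` in probability, and it is an integer. -/
theorem tendsto_gibbs_windingNumber_eq_zero {J σ : ℕ → ℝ}
    (hJ : Tendsto (fun N => J N / σ N ^ 2) atTop atTop)
    (ho : (fun N : ℕ => (N : ℝ)) =o[atTop] (fun N => J N / σ N ^ 2)) :
    Tendsto (fun N => gibbs (J N) (σ N) N {x | WindingDefined x ∧ windingNumber x = 0})
      atTop (𝓝 1) := by
  set κ : ℕ → ℝ := fun N => J N / (2 * σ N ^ 2) with hκdef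
  have hκ2 : ∀ N, κ N = J N / σ N ^ 2 / 2 := fun N => by rw [hκdef]; ring
  have hκ : Tendsto κ atTop atTop := by
    simp only [funext hκ2]
    exact hJ.atTop_div_const two_pos
  have hκN : Tendsto (fun N : ℕ => κ N / N) atTop atTop := by
    have h := ho.tendsto_div_nhds_zero
    have hpos : ∀ᶠ N : ℕ in atTop, 0 < (N : ℝ) / (J N / σ N ^ 2) := by
      filter_upwards [hJ.eventually_gt_atTop 0, eventually_gt_atTop 0] with N h1 h2
      have : (0 : ℝ) < N := by exact_mod_cast h2
      positivity
    have h2 := (tendsto_inv_nhdsGT_zero.comp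
      (tendsto_nhdsWithin_iff.mpr ⟨h, hpos⟩)).atTop_div_const two_pos
    refine h2.congr fun N => ?_
    rw [hκ2, Function.comp, inv_div]
    ring
  set ν : ℕ → Measure ℝ := fun N => (gibbs (J N) (σ N) N).map windingNumber with hν
  have hνp : ∀ N, IsProbabilityMeasure (ν N) := fun N =>
    Measure.isProbabilityMeasure_map (measurable_windingNumber N).aemeasurable
  have hchar : ∀ t, Tendsto (fun N => charFun (ν N) t) atTop (𝓝 1) := fun t => by
    have h := (Complex.continuous_ofReal.tendsto _).comp
      (tendsto_transferTrace_div hκ hκN (t * (1 / (2 * Real.pi))))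
    rw [Complex.ofReal_one] at h
    refine h.congr' ?_
    filter_upwards [eventually_ge_atTop 2] with N hN
    exact (charFun_map_gibbs (J N) (σ N) (1 / (2 * Real.pi)) t hN).symm
  have hI : Tendsto (fun N => ∫ t in (-2 * (1 / 2 : ℝ)⁻¹)..(2 * (1 / 2 : ℝ)⁻¹), 1 - charFun (ν N) t)
      atTop (𝓝 0) := by
    have h := intervalIntegral.tendsto_integral_filter_of_dominated_convergence
      (μ := volume) (a := -2 * (1 / 2 : ℝ)⁻¹) (b := 2 * (1 / 2 : ℝ)⁻¹) (l := atTop)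
      (F := fun N t => 1 - charFun (ν N) t) (f := fun _ => 0) (fun _ => 2) ?_ ?_ ?_ ?_
    · simpa using h
    · exact Eventually.of_forall fun N =>
        ((measurable_const (a := (1 : ℂ))).sub measurable_charFun).aestronglyMeasurable
    · refine Eventually.of_forall fun N => Eventually.of_forall fun t _ => ?_
      refine (norm_sub_le _ _).trans ?_
      have := norm_charFun_le_one (μ := ν N) (t := t)
      rw [norm_one]
      linarith
    · exact intervalIntegrable_const
    · refine Eventually.of_forall fun t _ => ?_
      simpa using (hchar t).const_sub 1
  have htail : Tendsto (fun N => (ν N).real {x | 1 / 2 < |x|}) atTop (𝓝 0) := by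
    refine squeeze_zero (fun _ => measureReal_nonneg)
      (fun N => measureReal_abs_gt_le_integral_charFun (by norm_num)) ?_
    simpa using (hI.norm.const_mul (2⁻¹ * (1 / 2 : ℝ)))
  have hset : ∀ᶠ N : ℕ in atTop, (gibbs (J N) (σ N) N)
      {x | WindingDefined x ∧ windingNumber x = 0} =
        1 - ENNReal.ofReal ((ν N).real {x | 1 / 2 < |x|}) := by
    filter_upwards [eventually_ge_atTop 2] with N hN
    have hms : MeasurableSet {y : ℝ | 1 / 2 < |y|} :=
      measurableSet_lt measurable_const measurable_id.abs
    have hpre := hms.preimage (measurable_windingNumber N)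
    rw [ofReal_measureReal, hν]
    simp only
    rw [Measure.map_apply (measurable_windingNumber N) hms, ← prob_compl_eq_one_sub hpre]
    refine measure_congr ?_
    filter_upwards [ae_windingDefined (J N) (σ N) hN] with x hx
    obtain ⟨n, hn⟩ := exists_int_windingNumber x
    refine propext ?_
    change (WindingDefined x ∧ windingNumber x = 0) ↔ ¬ (1 / 2 < |windingNumber x|)
    rw [hn]
    refine ⟨fun h => ?_, fun h => ⟨hx, ?_⟩⟩
    · rw [h.2]; norm_num
    · by_contra hne
      have hn0 : n ≠ 0 := by exact_mod_cast hne
      have : (1 : ℝ) ≤ |(n : ℝ)| := by exact_mod_cast Int.one_le_abs hn0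
      exact h (by linarith)
  have hlim := ENNReal.Tendsto.sub (tendsto_const_nhds (x := (1 : ENNReal)))
    (ENNReal.tendsto_ofReal htail) (Or.inl ENNReal.one_ne_top)
  rw [ENNReal.ofReal_zero, tsub_zero] at hlim
  exact hlim.congr' (hset.mono fun N hN => hN.symm)


end XYChain

end

theorem theorem1 (J σ : ℕ → ℝ) (hσ : ∀ N, 0 < σ N)
    (hJ : Tendsto (fun N => J N / σ N ^ 2) atTop atTop) :
    ((fun N => J N / σ N ^ 2) =o[atTop] (fun N : ℕ => (N : ℝ)) →
      TendstoInDistribution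
        (fun (N : ℕ) (x : XYChain.Config N) =>
          2 * Real.pi * Real.sqrt (J N / (2 * σ N ^ 2 * N)) * XYChain.windingNumber x)
        atTop (id : ℝ → ℝ) (fun N => XYChain.gibbs (J N) (σ N) N) (gaussianReal 0 1)) ∧
    ((fun N : ℕ => (N : ℝ)) =o[atTop] (fun N => J N / σ N ^ 2) →
      Tendsto
        (fun N => XYChain.gibbs (J N) (σ N) N
          {x | XYChain.WindingDefined x ∧ XYChain.windingNumber x = 0})
        atTop (𝓝 1)) :=
  ⟨XYChain.tendstoInDistribution_windingNumber hJ, XYChain.tendsto_gibbs_windingNumber_eq_zero hJ⟩
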